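/- Let $n\ge 1$, $\zeta_n=\exp(2\pi i/n)$, and let $\mathcal C=V\big((x^n-y^n)(y^n-z^n)(z^n-x^n)\big)\subset\mathbb{CP}^2$ be the $n$-th Fermat line arrangement. Let $0<\varepsilon\le \tfrac12$, and let $\delta>0$ be small, namely $\delta<\varepsilon$ and $\delta<\varepsilon|1-\zeta_n^k|$ for $0<k<n$. Put $\overline\epsilon=[1:\varepsilon:0]$. For $0\le i\le n-1$ let $g_i\in\pi_1\big(\mathbb{CP}^2-(\mathcal C\cup V(x)),\overline\epsilon\big)$ be the class of the loop $$g_i(t)=\begin{cases}[1:\varepsilon:t\,\zeta_n^{n-i}(\varepsilon-\delta)], & 0\le t\le 1,\\ [1:\varepsilon:\zeta_n^{n-i}(\varepsilon-\delta\exp(2\pi i(t-1)))], & 1\le t\le 2,\\ [1:\varepsilon:(3-t)\,\zeta_n^{n-i}(\varepsilon-\delta)], & 2\le t\le 3\end{cases}$$ (in the exponential, $i=\sqrt{-1}$), and let $\mathfrak g:=g_{n-1}\cdots g_1g_0$, where a product of loops is read from left to right, i.e. the leftmost loop is traversed first. Let $\gamma_0$ be the class of the loop $t\mapsto\varepsilon\exp(2\pi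 i t)$, $0\le t\le 1$, in $\pi_1(B_{2\varepsilon}(0)-\{0\},\varepsilon)$, where $B_{2\varepsilon}(0)\subset\mathbb C$ is the open disc, and let $$\mathrm{in}\colon B_{2\varepsilon}(0)-\{0\}\to\mathbb{CP}^2-(\mathcal C\cup V(x)),\qquad t\mapsto[1:t:0].$$ Then $$\mathrm{in}_*(\gamma_0)=\mathfrak g\quad\text{in }\pi_1\big(\mathbb{CP}^2-(\mathcal C\cup V(x)),\overline\epsilon\big).$$ -/

import Mathlib

namespace FermatArrangement

noncomputable section

open scoped LinearAlgebra.Projectivization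

/-- The complex projective plane. -/
abbrev CP2 : Type := ℙ ℂ (Fin 3 → ℂ)

/-- The usual topology of the projective plane: the quotient topology from `ℂ³ ∖ {0}`. -/
instance : TopologicalSpace CP2 :=
  inferInstanceAs (TopologicalSpace (Quotient (projectivizationSetoid ℂ (Fin 3 → ℂ))))

/-- The vanishing locus of a polynomial in the homogeneous coordinates
`x = X 0`, `y = X 1`, `z = X 2`. -/
def vanishingLocus (f : MvPolynomial (Fin 3) ℂ) : Set CP2 :=
  {p | ∀ (v : Fin 3 → ℂ) (hv : v ≠ 0), Projectivization.mk ℂ v hv = p →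
    MvPolynomial.eval v f = 0}

open MvPolynomial in
/-- The `n`-th Fermat arrangement `V((xⁿ - yⁿ)(yⁿ - zⁿ)(zⁿ - xⁿ))`. -/
def fermatCurve (n : ℕ) : Set CP2 :=
  vanishingLocus ((X 0 ^ n - X 1 ^ n) * (X 1 ^ n - X 2 ^ n) * (X 2 ^ n - X 0 ^ n))

/-- The complement of the union of the Fermat arrangement and the line `V(x)`. -/
def fermatComplement (n : ℕ) : Set CP2 :=
  (fermatCurve n ∪ vanishingLocus (MvPolynomial.X 0))ᶜ

lemma affine_ne_zero (y z : ℂ) : (![1, y, z] : Fin 3 → ℂ) ≠ 0 := by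
  intro h
  simpa using congrFun h 0

/-- The point `[1 : y : z]`. -/
def affinePoint (y z : ℂ) : CP2 := Projectivization.mk ℂ ![1, y, z] (affine_ne_zero y z)

lemma continuous_affinePoint : Continuous fun w : ℂ × ℂ => affinePoint w.1 w.2 := by
  have h : Continuous fun w : ℂ × ℂ =>
      (⟨![1, w.1, w.2], affine_ne_zero w.1 w.2⟩ : {v : Fin 3 → ℂ // v ≠ 0}) := by
    refine Continuous.subtype_mk (continuous_pi fun i => ?_) _
    fin_cases i <;> simp <;> fun_prop
  exact continuous_quotient_mk'.comp h

lemma affinePoint_mem {n : ℕ} {y z : ℂ} (hy : y ^ n ≠ 1) (hyz : y ^ n ≠ z ^ n) (hz : z ^ n ≠ 1) :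
    affinePoint y z ∈ fermatComplement n := by
  rintro (h | h)
  · have h' := h _ (affine_ne_zero y z) rfl
    simp only [map_mul, map_sub, map_pow, MvPolynomial.eval_X, Matrix.cons_val_zero,
      Matrix.cons_val_one, Matrix.cons_val, one_pow, mul_eq_zero, sub_eq_zero] at h'
    rcases h' with (h' | h') | h'
    · exact hy h'.symm
    · exact hyz h'
    · exact hz h'
  · have h' := h _ (affine_ne_zero y z) rfl
    simp at h'

/-- The primitive root of unity `exp(2πi/n)`. -/
def zeta (n : ℕ) : ℂ := Complex.exp (2 * Real.pi * Complex.I / n)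

/-- The smallness conditions: the disc of radius `2ε` contains no `n`-th root of unity, and the
closed disc of radius `δ` around any one of the `n` points `ε ζⁱ` contains neither the origin nor
another one of them. -/
structure Small (n : ℕ) (ε δ : ℝ) : Prop where
  eps_pos : 0 < ε
  eps_le : ε ≤ 1 / 2
  delta_pos : 0 < δ
  delta_lt : δ < ε
  delta_sep : ∀ k : ℕ, 0 < k → k < n → δ < ε * ‖1 - zeta n ^ k‖

/-- The punctured disc `B_{2ε}(0) ∖ {0}`. -/
abbrev puncturedDisc (ε : ℝ) : Set ℂ := Metric.ball (0 : ℂ) (2 * ε) \ {0}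

lemma pow_ne_one_of_norm_lt {n : ℕ} (hn : 1 ≤ n) {z : ℂ} (hz : ‖z‖ < 1) : z ^ n ≠ 1 := by
  intro h
  have h1 := pow_lt_one₀ (norm_nonneg z) hz (by omega : n ≠ 0)
  rw [← norm_pow, h, norm_one] at h1
  exact lt_irrefl _ h1

lemma pow_ne_pow_of_norm_lt {n : ℕ} (hn : 1 ≤ n) {y z : ℂ} (hz : ‖z‖ < ‖y‖) : y ^ n ≠ z ^ n := by
  intro h
  have h1 := pow_lt_pow_left₀ hz (norm_nonneg z) (by omega : n ≠ 0)
  rw [← norm_pow, ← norm_pow, h] at h1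
  exact lt_irrefl _ h1

lemma disc_mem {n : ℕ} (hn : 1 ≤ n) {ε δ : ℝ} (h : Small n ε δ) (t : puncturedDisc ε) :
    affinePoint (t : ℂ) 0 ∈ fermatComplement n := by
  obtain ⟨t, ht, ht0⟩ := t
  have h1 : ‖t‖ < 2 * ε := by simpa using ht
  have h2 : t ≠ 0 := by simpa using ht0
  have h3 := h.eps_le
  exact affinePoint_mem (pow_ne_one_of_norm_lt hn (by linarith))
    (pow_ne_pow_of_norm_lt hn (by simpa using h2)) (pow_ne_one_of_norm_lt hn (by simp))

/-- The inclusion `t ↦ [1 : t : 0]` of the punctured disc. -/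
def incl {n : ℕ} (hn : 1 ≤ n) {ε δ : ℝ} (h : Small n ε δ) :
    C(puncturedDisc ε, fermatComplement n) where
  toFun t := ⟨affinePoint (t : ℂ) 0, disc_mem hn h t⟩
  continuous_toFun := Continuous.subtype_mk
    (continuous_affinePoint.comp (continuous_subtype_val.prodMk continuous_const)) _

lemma norm_exp_turn (t : ℝ) : ‖Complex.exp (2 * Real.pi * Complex.I * t)‖ = 1 := by
  have : (2 * Real.pi * Complex.I * t : ℂ) = ((2 * Real.pi * t : ℝ) : ℂ) * Complex.I := by
    push_cast; ring
  rw [this, Complex.norm_exp_ofReal_mul_I]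

lemma circle_mem {n : ℕ} {ε δ : ℝ} (h : Small n ε δ) (t : ℝ) :
    (ε : ℂ) * Complex.exp (2 * Real.pi * Complex.I * t) ∈ puncturedDisc ε := by
  have h1 := h.eps_pos
  have h2 : ‖(ε : ℂ) * Complex.exp (2 * Real.pi * Complex.I * t)‖ = ε := by
    rw [norm_mul, norm_exp_turn, Complex.norm_real, Real.norm_of_nonneg h1.le, mul_one]
  refine ⟨?_, ?_⟩
  · rw [mem_ball_zero_iff, h2]
    linarith
  · intro h0
    rw [Set.mem_singleton_iff] at h0
    rw [h0, norm_zero] at h2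
    exact h1.ne h2

lemma eps_mem {n : ℕ} {ε δ : ℝ} (h : Small n ε δ) : (ε : ℂ) ∈ puncturedDisc ε := by
  simpa using circle_mem h 0

/-- The point `ε` of the punctured disc. -/
def discBase {n : ℕ} {ε δ : ℝ} (h : Small n ε δ) : puncturedDisc ε := ⟨ε, eps_mem h⟩

/-- The loop `t ↦ ε exp(2πit)` in the punctured disc. -/
def gammaZeroLoop {n : ℕ} {ε δ : ℝ} (h : Small n ε δ) : Path (discBase h) (discBase h) where
  toFun t := ⟨(ε : ℂ) * Complex.exp (2 * Real.pi * Complex.I * (t : ℝ)), circle_mem h t⟩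
  continuous_toFun := by
    refine Continuous.subtype_mk ?_ _
    fun_prop
  source' := by simp [discBase]
  target' := by simp [discBase]

/-- The class `γ₀` in the fundamental group of the punctured disc. -/
def gammaZero {n : ℕ} {ε δ : ℝ} (h : Small n ε δ) :
    FundamentalGroup (puncturedDisc ε) (discBase h) :=
  FundamentalGroup.fromPath (Path.Homotopic.Quotient.mk (gammaZeroLoop h))

/-- The values of `z` for which `[1 : ε : z]` is not on the lines `yⁿ = zⁿ` and `zⁿ = xⁿ`. -/
def fibre (n : ℕ) (ε : ℝ) : Set ℂ := {z | (ε : ℂ) ^ n ≠ z ^ n ∧ z ^ n ≠ 1}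

lemma eps_pow_ne_one {n : ℕ} (hn : 1 ≤ n) {ε δ : ℝ} (h : Small n ε δ) : (ε : ℂ) ^ n ≠ 1 := by
  refine pow_ne_one_of_norm_lt hn ?_
  rw [Complex.norm_real, Real.norm_of_nonneg h.eps_pos.le]
  linarith [h.eps_le]

/-- The inclusion `z ↦ [1 : ε : z]` of the fibre `y / x = ε`. -/
def fibreIncl {n : ℕ} (hn : 1 ≤ n) {ε δ : ℝ} (h : Small n ε δ) :
    C(fibre n ε, fermatComplement n) where
  toFun z := ⟨affinePoint ε z, affinePoint_mem (eps_pow_ne_one hn h) z.2.1 z.2.2⟩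
  continuous_toFun := Continuous.subtype_mk
    (continuous_affinePoint.comp (continuous_const.prodMk continuous_subtype_val)) _

lemma zeta_pow_card {n : ℕ} (hn : 1 ≤ n) : zeta n ^ n = 1 :=
  (Complex.isPrimitiveRoot_exp n (by omega)).pow_eq_one

lemma norm_zeta_pow (n : ℕ) (j : ℕ) : ‖zeta n ^ j‖ = 1 := by
  have : (2 * Real.pi * Complex.I / n : ℂ) = ((2 * Real.pi / n : ℝ) : ℂ) * Complex.I := by
    push_cast; ring
  rw [norm_pow, zeta, this, Complex.norm_exp_ofReal_mul_I, one_pow]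

lemma mem_fibre_of_norm_lt {n : ℕ} (hn : 1 ≤ n) {ε δ : ℝ} (h : Small n ε δ) {z : ℂ}
    (hz : ‖z‖ < ε) : z ∈ fibre n ε := by
  refine ⟨pow_ne_pow_of_norm_lt hn ?_, pow_ne_one_of_norm_lt hn (by linarith [h.eps_le])⟩
  rwa [Complex.norm_real, Real.norm_of_nonneg h.eps_pos.le]

/-- The origin of the fibre, i.e. the base point `[1 : ε : 0]`. -/
def fibreBase {n : ℕ} (hn : 1 ≤ n) {ε δ : ℝ} (h : Small n ε δ) : fibre n ε :=
  ⟨0, mem_fibre_of_norm_lt hn h (by simpa using h.eps_pos)⟩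

lemma segment_mem {n : ℕ} (hn : 1 ≤ n) {ε δ : ℝ} (h : Small n ε δ) (j : ℕ) {t : ℝ}
    (ht0 : 0 ≤ t) (ht1 : t ≤ 1) : (t : ℂ) * (zeta n ^ j * ((ε : ℂ) - δ)) ∈ fibre n ε := by
  refine mem_fibre_of_norm_lt hn h ?_
  rw [norm_mul, norm_mul, norm_zeta_pow, one_mul, ← Complex.ofReal_sub, Complex.norm_real,
    Complex.norm_real, Real.norm_of_nonneg ht0,
    Real.norm_of_nonneg (by linarith [h.delta_lt] : (0 : ℝ) ≤ ε - δ)]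
  nlinarith [h.delta_lt, h.delta_pos]

lemma smallCircle_mem {n : ℕ} (hn : 1 ≤ n) {ε δ : ℝ} (h : Small n ε δ) (j : ℕ) (t : ℝ) :
    zeta n ^ j * ((ε : ℂ) - δ * Complex.exp (2 * Real.pi * Complex.I * t)) ∈ fibre n ε := by
  have hε : (ε : ℂ) ≠ 0 := Complex.ofReal_ne_zero.2 h.eps_pos.ne'
  set e := Complex.exp (2 * Real.pi * Complex.I * t) with he
  have he1 : ‖e‖ = 1 := norm_exp_turn t
  have hδ : ‖(δ : ℂ) * e‖ = δ := by
    rw [norm_mul, he1, Complex.norm_real, Real.norm_of_nonneg h.delta_pos.le, mul_one]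
  have hεn : ‖(ε : ℂ)‖ = ε := by rw [Complex.norm_real, Real.norm_of_nonneg h.eps_pos.le]
  refine ⟨fun heq => ?_, pow_ne_one_of_norm_lt hn ?_⟩
  · have hj : (zeta n ^ j) ^ n = 1 := by
      rw [← pow_mul, mul_comm, pow_mul, zeta_pow_card hn, one_pow]
    rw [mul_pow, hj, one_mul] at heq
    have hroot : (((ε : ℂ) - δ * e) / ε) ^ n = 1 := by
      rw [div_pow, ← heq, div_self (pow_ne_zero n hε)]
    have : NeZero n := ⟨by omega⟩
    obtain ⟨k, hk, hk'⟩ :=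
      (Complex.isPrimitiveRoot_exp n (by omega)).eq_pow_of_pow_eq_one hroot
    change zeta n ^ k = _ at hk'
    have hsub : (δ : ℂ) * e = ε * (1 - zeta n ^ k) := by
      rw [hk']
      field_simp
      ring
    have hnorm : δ = ε * ‖1 - zeta n ^ k‖ := by
      rw [← hδ, hsub, norm_mul, hεn]
    rcases Nat.eq_zero_or_pos k with rfl | hk0
    · simp only [pow_zero, sub_self, norm_zero, mul_zero] at hnorm
      exact h.delta_pos.ne' hnorm
    · exact (h.delta_sep k hk0 hk).ne hnorm
  · rw [norm_mul, norm_zeta_pow, one_mul]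
    calc ‖(ε : ℂ) - δ * e‖ ≤ ‖(ε : ℂ)‖ + ‖(δ : ℂ) * e‖ := norm_sub_le _ _
      _ = ε + δ := by rw [hδ, hεn]
      _ < 1 := by linarith [h.eps_le, h.delta_lt]

/-- The point `ζʲ(ε - δ)` of the fibre. -/
def nearPoint {n : ℕ} (hn : 1 ≤ n) {ε δ : ℝ} (h : Small n ε δ) (j : ℕ) : fibre n ε :=
  ⟨zeta n ^ j * ((ε : ℂ) - δ), by simpa using smallCircle_mem hn h j 0⟩

/-- The straight path `t ↦ t ζʲ(ε - δ)` in the fibre. -/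
def segmentPath {n : ℕ} (hn : 1 ≤ n) {ε δ : ℝ} (h : Small n ε δ) (j : ℕ) :
    Path (fibreBase hn h) (nearPoint hn h j) where
  toFun t := ⟨((t : ℝ) : ℂ) * (zeta n ^ j * ((ε : ℂ) - δ)), segment_mem hn h j t.2.1 t.2.2⟩
  continuous_toFun := by
    refine Continuous.subtype_mk ?_ _
    fun_prop
  source' := by simp [fibreBase]
  target' := by simp [nearPoint]

/-- The circle `t ↦ ζʲ(ε - δ exp(2πit))` about `ε ζʲ` in the fibre. -/
def circlePath {n : ℕ} (hn : 1 ≤ n) {ε δ : ℝ} (h : Small n ε δ) (j : ℕ) :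
    Path (nearPoint hn h j) (nearPoint hn h j) where
  toFun t := ⟨zeta n ^ j * ((ε : ℂ) - δ * Complex.exp (2 * Real.pi * Complex.I * (t : ℝ))),
    smallCircle_mem hn h j t⟩
  continuous_toFun := by
    refine Continuous.subtype_mk ?_ _
    fun_prop
  source' := by simp [nearPoint]
  target' := by simp [nearPoint]

/-- The base point `[1 : ε : 0]`. -/
def basePoint {n : ℕ} (hn : 1 ≤ n) {ε δ : ℝ} (h : Small n ε δ) : fermatComplement n :=
  ⟨affinePoint ε 0, disc_mem hn h (discBase h)⟩

/-- The class `gᵢ`, in the fundamental group of the complement, of the loop in the fibre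
`y / x = ε` that goes straight from `[1 : ε : 0]` towards `[1 : ε : ε ζⁿ⁻ⁱ]`, once counterclockwise
around that point on the circle of radius `δ`, and straight back. -/
def g {n : ℕ} (hn : 1 ≤ n) {ε δ : ℝ} (h : Small n ε δ) (i : ℕ) :
    FundamentalGroup (fermatComplement n) (basePoint hn h) :=
  FundamentalGroup.fromPath <| Path.Homotopic.Quotient.mk <|
    (((segmentPath hn h (n - i)).trans (circlePath hn h (n - i))).trans
      (segmentPath hn h (n - i)).symm).map (fibreIncl hn h).continuous

/-- The product of a list of classes of loops, read from left to right: the leftmost loop is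
traversed first. (The multiplication of Mathlib's `FundamentalGroup` is the opposite one:
there `p * q` traverses `q` first.) -/
def concatProd {X : Type*} [TopologicalSpace X] {x : X} (l : List (FundamentalGroup X x)) :
    FundamentalGroup X x :=
  l.foldr (fun p q => FundamentalGroup.fromPath (p.toPath.trans q.toPath)) 1

/-- The cyclic product `𝔤 = gₙ₋₁ ⋯ g₁ g₀`. -/
def cyclicProduct {n : ℕ} (hn : 1 ≤ n) {ε δ : ℝ} (h : Small n ε δ) :
    FundamentalGroup (fermatComplement n) (basePoint hn h) :=
  concatProd ((List.range n).reverse.map (g hn h))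

end

end FermatArrangement

/-! Work in the affine chart with coordinates `(y, z)`. In the fibre `y = ε`, the loop around `ε ζʲ`
is pushed outwards to a sector loop: out along the ray of argument `(2j - 1)π/n`, along the circle
`|z| = 3/4`, back along the ray of argument `(2j + 1)π/n` (`fibreLoop_homotopic`). The product `gₙ₋₁
⋯ g₀` visits `j = 1, …, n` in this order, so neighbouring rays cancel and one sector loop remains,
from argument `π/n` through a full turn (`cyclicProduct_eq`).

This loop then leaves the fibre. While `|z| = 3/4`, the coordinate `y` may move anywhere in the disc
`|y| ≤ ε`, since `y = 0` is not a line of the arrangement; so `y` can be made to turn once together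
with `z` (`arc_homotopic_diagonalArc`). Along the resulting path the direction of `z / y` is
constant and `(z / y)ⁿ` is a nonpositive real, hence never `1`. Shrinking `z` radially to `0`
therefore stays in the complement and leaves `y = ε exp(2πit)`, `z = 0`, which is the image of `γ₀`
(`diagonal_homotopic`).

No homotopy is written down: two paths are homotopic once both lift to a simply connected space,
which is a star-shaped set, a convex set or the real line. -/

/-! ### Homotopies through simply connected spaces. -/

/-- Two paths that are images of paths with common endpoints in a simply connected space are
homotopic. -/
lemma Path.homotopic_of_lift {X Y : Type*} [TopologicalSpace X] [TopologicalSpace Y]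
    [SimplyConnectedSpace Y] {f : Y → X} (hf : Continuous f) {k l : Y} (P Q : Path k l) {x y : X}
    (p q : Path x y) (hp : ∀ t, p t = f (P t)) (hq : ∀ t, q t = f (Q t)) : p.Homotopic q := by
  obtain rfl : x = f k := by simpa using hp 0
  obtain rfl : y = f l := by simpa using hp 1
  have hp' : p = P.map hf := Path.ext (funext hp)
  have hq' : q = Q.map hf := Path.ext (funext hq)
  rw [hp', hq']
  exact (SimplyConnectedSpace.paths_homotopic P Q).map ⟨f, hf⟩

/-- Two paths with common endpoints in a star-shaped subset are homotopic. -/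
lemma Path.homotopic_of_starConvex {E : Type*} [AddCommGroup E] [Module ℝ E] [TopologicalSpace E]
    [ContinuousAdd E] [ContinuousSMul ℝ E] {F S : Set E} {c : E} (hS : StarConvex ℝ c S)
    (hSF : S ⊆ F) {a b : F} (p q : Path a b) (hp : ∀ t, (p t : E) ∈ S)
    (hq : ∀ t, (q t : E) ∈ S) : p.Homotopic q := by
  have ha : (a : E) ∈ S := by simpa using hp 0
  have hb : (b : E) ∈ S := by simpa using hp 1
  have : ContractibleSpace S := hS.contractibleSpace ⟨_, ha⟩
  let lift (r : Path a b) (hr : ∀ t, (r t : E) ∈ S) : Path (⟨a, ha⟩ : S) ⟨b, hb⟩ :=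
    { toFun := fun t => ⟨r t, hr t⟩
      continuous_toFun := (continuous_subtype_val.comp r.continuous).subtype_mk _
      source' := by simp
      target' := by simp }
  exact Path.homotopic_of_lift (continuous_inclusion hSF) (lift p hp) (lift q hq) p q
    (fun _ => rfl) fun _ => rfl

lemma Path.forall_trans {X : Type*} [TopologicalSpace X] {x y z : X} {p : Path x y} {q : Path y z}
    {C : X → Prop} (hp : ∀ t, C (p t)) (hq : ∀ t, C (q t)) (t : unitInterval) :
    C ((p.trans q) t) := by
  rw [Path.trans_apply]
  split_ifs
  exacts [hp _, hq _]

/-- A convex subset of a closed half plane remains star-shaped when a real point is removed. -/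
lemma Convex.starConvex_diff_ofReal {K : Set ℂ} (hK : Convex ℝ K) {σ : ℝ} {w₀ : ℂ} (hw₀ : w₀ ∈ K)
    (hσ : 0 < σ * w₀.im) (hKσ : ∀ w ∈ K, 0 ≤ σ * w.im) (r : ℝ) :
    StarConvex ℝ w₀ (K \ {(r : ℂ)}) := by
  rintro w ⟨hw, hwr⟩ a b ha hb hab
  refine ⟨hK hw₀ hw ha hb hab, fun h => ?_⟩
  rw [Set.mem_singleton_iff] at h
  -- A real point of the segment has imaginary part zero, a sum of two terms of the same sign; this
  -- forces `a = 0`, so the point is the end `w`.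
  have him : a * w₀.im + b * w.im = 0 := by simpa using congrArg Complex.im h
  have h1 : a * (σ * w₀.im) + b * (σ * w.im) = 0 := by linear_combination σ * him
  have h2 := mul_nonneg hb (hKσ w hw)
  have h3 : a = 0 := by
    by_contra h0
    have := mul_pos (lt_of_le_of_ne ha (Ne.symm h0)) hσ
    linarith
  obtain rfl : b = 1 := by linarith
  exact hwr (by simpa [h3] using h)

lemma Path.lift_of_joinedIn {E : Type*} [TopologicalSpace E] {F S : Set E} (hSF : S ⊆ F) {a b : F}
    (h : JoinedIn S (a : E) b) : ∃ p : Path a b, ∀ t, (p t : E) ∈ S := by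
  refine ⟨{ toFun := fun t => ⟨h.somePath t, hSF (h.somePath_mem t)⟩
            continuous_toFun := h.somePath.continuous.subtype_mk _
            source' := by simp
            target' := by simp }, fun t => h.somePath_mem t⟩

namespace FermatArrangement

/-! ### Half sectors and half discs, and the roots of `wⁿ = εⁿ` in them. -/

/-- Provides the height `η` for which `ε ± iη` lies in both the half disc and the half sector; that
point serves as a common star centre. -/
lemma exists_height {n : ℕ} (hn : 1 ≤ n) {ε δ : ℝ} (hδ : 0 < δ) (hδε : δ < ε) : ∃ η, 0 < η ∧ η ≤ δ ∧
      Real.cos (Real.pi / n) * η ≤ Real.sin (Real.pi / n) * ε := by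
  rcases hn.eq_or_lt with rfl | hn
  -- Here `sin π = 0`, so the witness of the other case would vanish; but the half sector is a half
  -- disc and any height works.
  · exact ⟨δ, hδ, le_rfl, by simp; linarith⟩
  · have h2 : (1 : ℝ) < n := by exact_mod_cast hn
    have hs : 0 < Real.sin (Real.pi / n) :=
      Real.sin_pos_of_pos_of_lt_pi (by positivity) (div_lt_self Real.pi_pos h2)
    have hs1 := Real.sin_le_one (Real.pi / n)
    have hc1 := Real.cos_le_one (Real.pi / n)
    refine ⟨Real.sin (Real.pi / n) * δ, by positivity, by nlinarith, ?_⟩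
    nlinarith [mul_pos hs hδ]

/-- The half sector of angle `π / n` in the open unit disc, above (`σ = 1`) or below (`σ = -1`)
the nonnegative reals. -/
def halfSector (n : ℕ) (σ : ℝ) : Set ℂ :=
  {w | ‖w‖ < 1 ∧ 0 ≤ σ * w.im ∧
    Real.cos (Real.pi / n) * (σ * w.im) ≤ Real.sin (Real.pi / n) * w.re}

/-- The closed upper (`σ = 1`) or lower (`σ = -1`) half disc. -/
def halfDisc (ε δ σ : ℝ) : Set ℂ := {w | ‖w - ε‖ ≤ δ ∧ 0 ≤ σ * w.im}

lemma convex_halfSector (n : ℕ) (σ : ℝ) : Convex ℝ (halfSector n σ) := by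
  have h1 : Convex ℝ {w : ℂ | ‖w‖ < 1} := by
    simpa [Metric.ball, dist_zero_right] using convex_ball (0 : ℂ) 1
  rintro v ⟨hv, hv0, hv1⟩ w ⟨hw, hw0, hw1⟩ a b ha hb hab
  refine ⟨h1 hv hw ha hb hab, ?_, ?_⟩
  · simp only [Complex.add_im, Complex.real_smul, Complex.im_ofReal_mul]
    nlinarith [mul_nonneg ha hv0, mul_nonneg hb hw0]
  · simp only [Complex.add_im, Complex.add_re, Complex.real_smul, Complex.re_ofReal_mul,
      Complex.im_ofReal_mul]
    nlinarith [mul_le_mul_of_nonneg_left hv1 ha, mul_le_mul_of_nonneg_left hw1 hb]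

lemma convex_halfDisc (ε δ σ : ℝ) : Convex ℝ (halfDisc ε δ σ) := by
  have h1 : Convex ℝ {w : ℂ | ‖w - ε‖ ≤ δ} := by
    simpa [Metric.closedBall, dist_eq_norm] using convex_closedBall (ε : ℂ) δ
  rintro v ⟨hv, hv0⟩ w ⟨hw, hw0⟩ a b ha hb hab
  refine ⟨h1 hv hw ha hb hab, ?_⟩
  simp only [Complex.add_im, Complex.real_smul, Complex.im_ofReal_mul]
  nlinarith [mul_nonneg ha hv0, mul_nonneg hb hw0]

/-- The argument `φ` of `w` lies in `[0, π/n]`, so `nφ` lies in `[0, π]`, where the cosine takes the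
value `1` only at `0`. -/
lemma eq_of_pow_eq_of_mem_upper {n : ℕ} (hn : 1 ≤ n) {ε : ℝ} (hε : 0 < ε) {w : ℂ}
    (h0 : 0 ≤ w.im)
    (h1 : Real.cos (Real.pi / n) * w.im ≤ Real.sin (Real.pi / n) * w.re)
    (hw : w ^ n = (ε : ℂ) ^ n) : w = ε := by
  have hn0 : (0 : ℝ) < n := by exact_mod_cast hn
  have hnorm : ‖w‖ = ε := by
    have := congrArg norm hw
    rw [norm_pow, norm_pow, Complex.norm_real, Real.norm_of_nonneg hε.le] at this
    exact (pow_left_inj₀ (norm_nonneg _) hε.le (by omega)).1 this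
  set φ := Complex.arg w with hφ
  have hφ0 : 0 ≤ φ := Complex.arg_nonneg_iff.2 h0
  have hφπ : φ ≤ Real.pi := Complex.arg_le_pi w
  have hpolar : w = ε * Complex.exp (φ * Complex.I) := by
    rw [← hnorm]; exact (Complex.norm_mul_exp_arg_mul_I w).symm
  have hre : w.re = ε * Real.cos φ := by
    rw [hpolar, Complex.re_ofReal_mul, Complex.exp_ofReal_mul_I_re]
  have him : w.im = ε * Real.sin φ := by
    rw [hpolar, Complex.im_ofReal_mul, Complex.exp_ofReal_mul_I_im]
  have hle : φ ≤ Real.pi / n := by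
    -- In polar form, `h1` says that `sin (φ - π/n) ≤ 0`.
    by_contra! hlt
    have hs : 0 < Real.sin (φ - Real.pi / n) := by
      refine Real.sin_pos_of_pos_of_lt_pi (by linarith) ?_
      have : 0 < Real.pi / n := by positivity
      linarith
    rw [Real.sin_sub] at hs
    rw [hre, him] at h1
    nlinarith [mul_pos hε hs]
  have hnφ : n * φ ≤ Real.pi := by
    rw [le_div_iff₀ hn0] at hle; linarith
  have hcos : Real.cos (n * φ) = 1 := by
    rw [hpolar, mul_pow] at hw
    have h2 : Complex.exp (φ * Complex.I) ^ n = 1 :=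
      mul_left_cancel₀ (pow_ne_zero n (Complex.ofReal_ne_zero.2 hε.ne')) (by rw [hw, mul_one])
    rw [← Complex.exp_nat_mul] at h2
    have h3 := congrArg Complex.re h2
    rw [show (n : ℂ) * (φ * Complex.I) = ((n * φ : ℝ) : ℂ) * Complex.I by push_cast; ring,
      Complex.exp_ofReal_mul_I_re] at h3
    simpa using h3
  have hzero : n * φ = 0 :=
    Real.injOn_cos ⟨by positivity, hnφ⟩ ⟨le_rfl, Real.pi_pos.le⟩ (by simpa using hcos)
  have : φ = 0 := by
    rcases mul_eq_zero.1 hzero with h | h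
    · exact absurd h hn0.ne'
    · exact h
  rw [hpolar, this]
  simp

lemma eq_of_pow_eq_of_mem_halfSector {n : ℕ} (hn : 1 ≤ n) {ε σ : ℝ} (hε : 0 < ε)
    (hσ : σ = 1 ∨ σ = -1) {w : ℂ} (h : w ∈ halfSector n σ) (hw : w ^ n = (ε : ℂ) ^ n) :
    w = ε := by
  obtain ⟨-, h0, h1⟩ := h
  rcases hσ with rfl | rfl
  · exact eq_of_pow_eq_of_mem_upper hn hε (by simpa using h0) (by simpa using h1) hw
  -- Complex conjugation exchanges the two half sectors and fixes `ε`.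
  · have h2 := eq_of_pow_eq_of_mem_upper (w := (starRingEnd ℂ) w) hn hε (by simpa using h0)
      (by simpa using h1) (by rw [← map_pow, hw]; simp)
    have := congrArg (starRingEnd ℂ) h2
    simpa using this

/-- Any other root `ε ζᵏ` is at distance `ε |1 - ζᵏ| > δ` from `ε`. -/
lemma eq_of_pow_eq_of_mem_halfDisc {n : ℕ} (hn : 1 ≤ n) {ε δ σ : ℝ} (h : Small n ε δ) {w : ℂ}
    (hw : w ∈ halfDisc ε δ σ) (heq : w ^ n = (ε : ℂ) ^ n) : w = ε := by
  have hε : (ε : ℂ) ≠ 0 := Complex.ofReal_ne_zero.2 h.eps_pos.ne'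
  have hroot : (w / ε) ^ n = 1 := by rw [div_pow, heq, div_self (pow_ne_zero n hε)]
  have : NeZero n := ⟨by omega⟩
  obtain ⟨k, hk, hk'⟩ := (Complex.isPrimitiveRoot_exp n (by omega)).eq_pow_of_pow_eq_one hroot
  change zeta n ^ k = _ at hk'
  have hw' : w = ε * zeta n ^ k := by rw [hk']; field_simp
  rcases Nat.eq_zero_or_pos k with rfl | hk0
  · simpa using hw'
  · have h1 : ‖w - ε‖ = ε * ‖1 - zeta n ^ k‖ := by
      rw [show w - ε = -(ε * (1 - zeta n ^ k)) by rw [hw']; ring, norm_neg, norm_mul,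
        Complex.norm_real, Real.norm_of_nonneg h.eps_pos.le]
    linarith [hw.1, h.delta_sep k hk0 hk]

/-- The rotate by `ζʲ` of a subset of the plane. -/
def rotate (n j : ℕ) (K : Set ℂ) : Set ℂ := {z | z / zeta n ^ j ∈ K}

lemma zeta_pow_ne_zero (n j : ℕ) : zeta n ^ j ≠ 0 := pow_ne_zero _ (Complex.exp_ne_zero _)

lemma starConvex_rotate {n j : ℕ} {K : Set ℂ} {c : ℂ} (hK : StarConvex ℝ c K) :
    StarConvex ℝ (zeta n ^ j * c) (rotate n j K) := by
  intro w hw a b ha hb hab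
  have h : (a • (zeta n ^ j * c) + b • w) / zeta n ^ j = a • c + b • (w / zeta n ^ j) := by
    have := zeta_pow_ne_zero n j
    simp only [Complex.real_smul]
    field_simp
  rw [rotate, Set.mem_ofPred_eq, h]
  exact hK hw ha hb hab

/-- The fibre is thus invariant under rotation by `ζʲ`, which reduces the geometry around `ε ζʲ` to
that around `ε`. -/
lemma div_zeta_pow_pow {n : ℕ} (hn : 1 ≤ n) (j : ℕ) (z : ℂ) : (z / zeta n ^ j) ^ n = z ^ n := by
  rw [div_pow, ← pow_mul, mul_comm j, pow_mul, zeta_pow_card hn, one_pow, div_one]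

lemma rotate_subset_fibre {n : ℕ} (hn : 1 ≤ n) (j : ℕ) {ε : ℝ} {K : Set ℂ}
    (h1 : ∀ w ∈ K, ‖w‖ < 1) (hK : ∀ w ∈ K, w ^ n = (ε : ℂ) ^ n → w = ε) :
    rotate n j (K \ {(ε : ℂ)}) ⊆ fibre n ε := by
  rintro z ⟨hz, hzε⟩
  refine ⟨fun h => hzε (hK _ hz ?_), fun h => pow_ne_one_of_norm_lt hn (h1 _ hz) ?_⟩
  · rw [div_zeta_pow_pow hn, h]
  · rw [div_zeta_pow_pow hn, h]

lemma mem_rotate_diff {n : ℕ} (hn : 1 ≤ n) {j : ℕ} {ε : ℝ} {K : Set ℂ} (z : fibre n ε)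
    (hz : (z : ℂ) / zeta n ^ j ∈ K) : (z : ℂ) ∈ rotate n j (K \ {(ε : ℂ)}) := by
  refine ⟨hz, fun h => z.2.1 ?_⟩
  rw [Set.mem_singleton_iff] at h
  rw [← h, div_zeta_pow_pow hn]

noncomputable section

/-! ### Rays, arcs and half circles in the fibre. -/

lemma mem_fibre_of_lt_norm {n : ℕ} (hn : 1 ≤ n) {ε δ : ℝ} (h : Small n ε δ) {z : ℂ}
    (hz : ε < ‖z‖) (hz1 : ‖z‖ < 1) : z ∈ fibre n ε := by
  refine ⟨(pow_ne_pow_of_norm_lt hn ?_).symm, pow_ne_one_of_norm_lt hn hz1⟩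
  rwa [Complex.norm_real, Real.norm_of_nonneg h.eps_pos.le]

lemma norm_ofReal_mul_exp {r : ℝ} (hr : 0 ≤ r) (θ : ℝ) :
    ‖(r : ℂ) * Complex.exp (θ * Complex.I)‖ = r := by
  rw [norm_mul, Complex.norm_exp_ofReal_mul_I, Complex.norm_real, Real.norm_of_nonneg hr, mul_one]

lemma zeta_pow_eq (n j : ℕ) :
    zeta n ^ j = Complex.exp ((2 * Real.pi * j / n : ℝ) * Complex.I) := by
  rw [zeta, ← Complex.exp_nat_mul]
  congr 1
  push_cast
  ring

/-- The radius `3 / 4` is chosen strictly between `ε ≤ 1 / 2` and `1`, hence between the roots of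
`zⁿ = εⁿ` and those of `zⁿ = 1`. -/
lemma outer_mem {n : ℕ} (hn : 1 ≤ n) {ε δ : ℝ} (h : Small n ε δ) (θ : ℝ) :
    ((3 / 4 : ℝ) : ℂ) * Complex.exp (θ * Complex.I) ∈ fibre n ε := by
  refine mem_fibre_of_lt_norm hn h ?_ ?_ <;> rw [norm_ofReal_mul_exp (by norm_num)]
  · linarith [h.eps_le]
  · norm_num

/-- The point of argument `θ` on the circle of radius `3 / 4` in the fibre. -/
def outerPoint {n : ℕ} (hn : 1 ≤ n) {ε δ : ℝ} (h : Small n ε δ) (θ : ℝ) : fibre n ε :=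
  ⟨((3 / 4 : ℝ) : ℂ) * Complex.exp (θ * Complex.I), outer_mem hn h θ⟩

lemma continuous_outerPoint {n : ℕ} (hn : 1 ≤ n) {ε δ : ℝ} (h : Small n ε δ) :
    Continuous (outerPoint hn h) := by
  refine Continuous.subtype_mk ?_ _
  fun_prop

/-- The affine path from `a` to `b` on the real line. -/
def realSegment (a b : ℝ) : Path a b where
  toFun t := a + (t : ℝ) * (b - a)
  continuous_toFun := by fun_prop
  source' := by simp
  target' := by simp

/-- The arc from argument `a` to argument `b` on the circle of radius `3 / 4`. -/
def arc {n : ℕ} (hn : 1 ≤ n) {ε δ : ℝ} (h : Small n ε δ) (a b : ℝ) :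
    Path (outerPoint hn h a) (outerPoint hn h b) :=
  (realSegment a b).map (continuous_outerPoint hn h)

/-- Arcs are images of paths of real arguments, so they inherit homotopies from the line, while a
full turn stays distinct from a constant arc. -/
lemma arc_trans {n : ℕ} (hn : 1 ≤ n) {ε δ : ℝ} (h : Small n ε δ) (a b c : ℝ) :
    ((arc hn h a b).trans (arc hn h b c)).Homotopic (arc hn h a c) := by
  rw [arc, arc, ← Path.map_trans]
  exact (SimplyConnectedSpace.paths_homotopic _ _).map ⟨_, continuous_outerPoint hn h⟩

lemma arc_symm {n : ℕ} (hn : 1 ≤ n) {ε δ : ℝ} (h : Small n ε δ) (a b : ℝ) :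
    (arc hn h a b).symm.Homotopic (arc hn h b a) := by
  rw [arc, Path.map_symm]
  exact (SimplyConnectedSpace.paths_homotopic _ _).map ⟨_, continuous_outerPoint hn h⟩

/-- On a ray whose argument is an odd multiple of `π/n`, the `n`-th power is a nonpositive real. It
is applied with `s = ε` and `s = 1`. -/
lemma ray_pow_ne {n : ℕ} {r s : ℝ} (hr : 0 ≤ r) (hs : 0 < s) {a : ℝ}
    (ha : Complex.exp (a * Complex.I) ^ n = -1) :
    ((r : ℂ) * Complex.exp (a * Complex.I)) ^ n ≠ (s : ℂ) ^ n := by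
  rw [mul_pow, ha]
  intro h
  have h1 : -r ^ n = s ^ n := by
    have : (((-r ^ n : ℝ)) : ℂ) = ((s ^ n : ℝ) : ℂ) := by push_cast; rw [← h]; ring
    exact_mod_cast this
  have := pow_nonneg hr n
  have := pow_pos hs n
  linarith

lemma ray_mem {n : ℕ} {ε δ : ℝ} (h : Small n ε δ) {r : ℝ} (hr : 0 ≤ r) {a : ℝ}
    (ha : Complex.exp (a * Complex.I) ^ n = -1) :
    (r : ℂ) * Complex.exp (a * Complex.I) ∈ fibre n ε :=
  ⟨(ray_pow_ne hr h.eps_pos ha).symm, by simpa using ray_pow_ne hr one_pos ha⟩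

/-- The radial path to the point of argument `a` on the circle of radius `3 / 4`, where `a` is an
odd multiple of `π / n`. -/
def ray {n : ℕ} (hn : 1 ≤ n) {ε δ : ℝ} (h : Small n ε δ) {a : ℝ}
    (ha : Complex.exp (a * Complex.I) ^ n = -1) : Path (fibreBase hn h) (outerPoint hn h a) where
  toFun t := ⟨((t * (3 / 4) : ℝ) : ℂ) * Complex.exp (a * Complex.I),
    ray_mem h (mul_nonneg t.2.1 (by norm_num)) ha⟩
  continuous_toFun := by
    refine Continuous.subtype_mk ?_ _
    fun_prop
  source' := by simp [fibreBase]
  target' := by simp [outerPoint]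

/-- The loop that goes out along a ray, follows an arc and comes back along another ray. -/
def sectorLoop {n : ℕ} (hn : 1 ≤ n) {ε δ : ℝ} (h : Small n ε δ) {a b : ℝ}
    (ha : Complex.exp (a * Complex.I) ^ n = -1) (hb : Complex.exp (b * Complex.I) ^ n = -1) :
    Path (fibreBase hn h) (fibreBase hn h) :=
  ((ray hn h ha).trans (arc hn h a b)).trans (ray hn h hb).symm

/-- The point `ζʲ(ε + δ)` of the fibre. -/
def farPoint {n : ℕ} (hn : 1 ≤ n) {ε δ : ℝ} (h : Small n ε δ) (j : ℕ) : fibre n ε := by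
  refine ⟨zeta n ^ j * ((ε : ℂ) + δ), ?_⟩
  have h1 := smallCircle_mem hn h j (1 / 2)
  rwa [show (2 * Real.pi * Complex.I * ((1 / 2 : ℝ) : ℂ) : ℂ) = Real.pi * Complex.I by
    push_cast; ring, Complex.exp_pi_mul_I, mul_neg, mul_one, sub_neg_eq_add] at h1

/-- The upper (`σ = 1`, clockwise) or lower (`σ = -1`, counterclockwise) half of the circle
of radius `δ` about `ε ζʲ`, from `ζʲ(ε - δ)` to `ζʲ(ε + δ)`. -/
def halfCircle {n : ℕ} (hn : 1 ≤ n) {ε δ : ℝ} (h : Small n ε δ) (j : ℕ) {σ : ℝ}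
    (hσ : σ = 1 ∨ σ = -1) : Path (nearPoint hn h j) (farPoint hn h j) where
  toFun t := ⟨zeta n ^ j *
    ((ε : ℂ) - δ * Complex.exp (2 * Real.pi * Complex.I * ((-σ * t / 2 : ℝ) : ℂ))),
    smallCircle_mem hn h j _⟩
  continuous_toFun := by
    refine Continuous.subtype_mk ?_ _
    fun_prop
  source' := by simp [nearPoint]
  target' := by
    have : Complex.exp (2 * Real.pi * Complex.I * ((-σ * 1 / 2 : ℝ) : ℂ)) = -1 := by
      rcases hσ with rfl | rfl
      · rw [show (2 * Real.pi * Complex.I * ((-1 * 1 / 2 : ℝ) : ℂ) : ℂ) = -(Real.pi * Complex.I) by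
          push_cast; ring, Complex.exp_neg, Complex.exp_pi_mul_I]
        norm_num
      · rw [show (2 * Real.pi * Complex.I * ((- -1 * 1 / 2 : ℝ) : ℂ) : ℂ) = Real.pi * Complex.I by
          push_cast; ring, Complex.exp_pi_mul_I]
    apply Subtype.ext
    simp only [Set.Icc.coe_one, this, farPoint]
    ring

lemma outward_mem {n : ℕ} (hn : 1 ≤ n) {ε δ : ℝ} (h : Small n ε δ) (j : ℕ) {r : ℝ}
    (hr : ε < r) (hr1 : r < 1) : zeta n ^ j * (r : ℂ) ∈ fibre n ε := by
  have h0 : ‖zeta n ^ j * (r : ℂ)‖ = r := by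
    rw [norm_mul, norm_zeta_pow, one_mul, Complex.norm_real,
      Real.norm_of_nonneg (h.eps_pos.trans hr).le]
  exact mem_fibre_of_lt_norm hn h (by rwa [h0]) (by rwa [h0])

/-- Both ends `ε + δ` and `3 / 4` lie in `(ε, 1)`. Either may be the larger, so the path may in fact
run inwards. -/
lemma outward_radius {n : ℕ} {ε δ : ℝ} (h : Small n ε δ) (t : unitInterval) :
    ε < ε + δ + t * (3 / 4 - (ε + δ)) ∧ ε + δ + t * (3 / 4 - (ε + δ)) < 1 := by
  obtain ⟨t, h0, h1⟩ := t
  have := h.eps_le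
  have := h.delta_lt
  have := h.delta_pos
  constructor
  · rcases h1.eq_or_lt with rfl | h1
    · linarith
    · nlinarith
  · rcases h1.eq_or_lt with rfl | h1
    · linarith
    · nlinarith

/-- The radial path from `ζʲ(ε + δ)` to the circle of radius `3 / 4`. -/
def outward {n : ℕ} (hn : 1 ≤ n) {ε δ : ℝ} (h : Small n ε δ) (j : ℕ) :
    Path (farPoint hn h j) (outerPoint hn h (2 * Real.pi * j / n)) where
  toFun t := ⟨zeta n ^ j * ((ε + δ + t * (3 / 4 - (ε + δ)) : ℝ) : ℂ),
    outward_mem hn h j (outward_radius h t).1 (outward_radius h t).2⟩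
  continuous_toFun := by
    refine Continuous.subtype_mk ?_ _
    fun_prop
  source' := by simp [farPoint]
  target' := by
    apply Subtype.ext
    simp only [outerPoint, zeta_pow_eq, Set.Icc.coe_one]
    push_cast
    ring

lemma coe_outward {n : ℕ} (hn : 1 ≤ n) {ε δ : ℝ} (h : Small n ε δ) (j : ℕ) (t : unitInterval) :
    (outward hn h j t : ℂ) = zeta n ^ j * ((ε + δ + t * (3 / 4 - (ε + δ)) : ℝ) : ℂ) := rfl

lemma coe_segmentPath {n : ℕ} (hn : 1 ≤ n) {ε δ : ℝ} (h : Small n ε δ) (j : ℕ)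
    (t : unitInterval) :
    (segmentPath hn h j t : ℂ) = ((t : ℝ) : ℂ) * (zeta n ^ j * ((ε : ℂ) - δ)) := rfl

lemma coe_circlePath {n : ℕ} (hn : 1 ≤ n) {ε δ : ℝ} (h : Small n ε δ) (j : ℕ)
    (t : unitInterval) : (circlePath hn h j t : ℂ) =
      zeta n ^ j * ((ε : ℂ) - δ * Complex.exp (2 * Real.pi * Complex.I * (t : ℝ))) := rfl

lemma coe_halfCircle {n : ℕ} (hn : 1 ≤ n) {ε δ : ℝ} (h : Small n ε δ) (j : ℕ) {σ : ℝ}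
    (hσ : σ = 1 ∨ σ = -1) (t : unitInterval) : (halfCircle hn h j hσ t : ℂ) = zeta n ^ j *
      ((ε : ℂ) - δ * Complex.exp (2 * Real.pi * Complex.I * ((-σ * t / 2 : ℝ) : ℂ))) := rfl

lemma coe_ray {n : ℕ} (hn : 1 ≤ n) {ε δ : ℝ} (h : Small n ε δ) {a : ℝ}
    (ha : Complex.exp (a * Complex.I) ^ n = -1) (t : unitInterval) :
    (ray hn h ha t : ℂ) = ((t * (3 / 4) : ℝ) : ℂ) * Complex.exp (a * Complex.I) := rfl

lemma coe_arc {n : ℕ} (hn : 1 ≤ n) {ε δ : ℝ} (h : Small n ε δ) (a b : ℝ) (t : unitInterval) :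
    (arc hn h a b t : ℂ) =
      ((3 / 4 : ℝ) : ℂ) * Complex.exp ((a + t * (b - a) : ℝ) * Complex.I) := rfl

/-- The circle starts at its point nearest the origin and turns counterclockwise, so its lower half
comes first. -/
lemma circlePath_eq_trans {n : ℕ} (hn : 1 ≤ n) {ε δ : ℝ} (h : Small n ε δ) (j : ℕ) :
    circlePath hn h j =
      (halfCircle hn h j (Or.inr rfl)).trans (halfCircle hn h j (Or.inl rfl)).symm := by
  ext t
  rw [Path.trans_apply]
  split_ifs with ht
  · rw [coe_circlePath, coe_halfCircle]
    congr 5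
    push_cast
    ring
  -- The two exponents differ by the period `2πi`.
  · rw [coe_circlePath, Path.symm_apply, Function.comp_apply, coe_halfCircle,
      ← Complex.exp_periodic.sub_eq]
    congr 4
    simp only [unitInterval.coe_symm_eq]
    push_cast
    ring

/-! ### Pushing half of a small loop out to the arc. -/

lemma polar_mem_halfSector {n : ℕ} (hn : 1 ≤ n) {σ : ℝ} (hσ : σ = 1 ∨ σ = -1) {r ψ : ℝ}
    (hr : 0 ≤ r) (hr1 : r < 1) (hψ : 0 ≤ ψ) (hψ1 : ψ ≤ Real.pi / n) :
    (r : ℂ) * Complex.exp ((σ * ψ : ℝ) * Complex.I) ∈ halfSector n σ := by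
  have hπ : Real.pi / n ≤ Real.pi := div_le_self Real.pi_pos.le (by exact_mod_cast hn)
  have h1 : σ * Real.sin (σ * ψ) = Real.sin ψ := by rcases hσ with rfl | rfl <;> simp
  have h2 : Real.cos (σ * ψ) = Real.cos ψ := by rcases hσ with rfl | rfl <;> simp
  have h3 : 0 ≤ Real.sin ψ := Real.sin_nonneg_of_nonneg_of_le_pi hψ (hψ1.trans hπ)
  -- Multiplied by `r`, this is the second inequality defining the half sector.
  have h4 : 0 ≤ Real.sin (Real.pi / n - ψ) :=
    Real.sin_nonneg_of_nonneg_of_le_pi (by linarith) (by linarith)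
  have him : σ * (r * Real.sin (σ * ψ)) = r * Real.sin ψ := by rw [← h1]; ring
  refine ⟨by rwa [norm_ofReal_mul_exp hr], ?_, ?_⟩
  · rw [Complex.im_ofReal_mul, Complex.exp_ofReal_mul_I_im, him]
    positivity
  · rw [Complex.im_ofReal_mul, Complex.exp_ofReal_mul_I_im, Complex.re_ofReal_mul,
      Complex.exp_ofReal_mul_I_re, him, h2]
    rw [Real.sin_sub] at h4
    nlinarith [mul_nonneg hr h4]

lemma ofReal_mem_halfSector {n : ℕ} (hn : 1 ≤ n) {σ : ℝ} (hσ : σ = 1 ∨ σ = -1) {r : ℝ}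
    (hr : 0 ≤ r) (hr1 : r < 1) : (r : ℂ) ∈ halfSector n σ := by
  simpa using polar_mem_halfSector hn hσ hr hr1 le_rfl (by positivity)

lemma halfDisc_lt_one {n : ℕ} {ε δ σ : ℝ} (h : Small n ε δ) {w : ℂ} (hw : w ∈ halfDisc ε δ σ) :
    ‖w‖ < 1 := by
  have h1 := norm_add_le (w - ε) (ε : ℂ)
  rw [sub_add_cancel, Complex.norm_real, Real.norm_of_nonneg h.eps_pos.le] at h1
  linarith [hw.1, h.eps_le, h.delta_lt]

lemma halfCircle_mem {n : ℕ} (hn : 1 ≤ n) {ε δ : ℝ} (h : Small n ε δ) (j : ℕ) {σ : ℝ}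
    (hσ : σ = 1 ∨ σ = -1) (t : unitInterval) :
    (halfCircle hn h j hσ t : ℂ) / zeta n ^ j ∈ halfDisc ε δ σ := by
  have h0 := zeta_pow_ne_zero n j
  rw [coe_halfCircle, mul_div_cancel_left₀ _ h0]
  constructor
  · rw [sub_sub_cancel_left, norm_neg, norm_mul, norm_exp_turn, mul_one, Complex.norm_real,
      Real.norm_of_nonneg h.delta_pos.le]
  · rw [show (2 * Real.pi * Complex.I * ((-σ * t / 2 : ℝ) : ℂ) : ℂ) =
      ((-(σ * (Real.pi * t)) : ℝ) : ℂ) * Complex.I by push_cast; ring,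
      Complex.sub_im, Complex.im_ofReal_mul, Complex.exp_ofReal_mul_I_im, Complex.ofReal_im,
      Real.sin_neg]
    have h1 : σ * Real.sin (σ * (Real.pi * t)) = Real.sin (Real.pi * t) := by
      rcases hσ with rfl | rfl <;> simp
    have h2 : 0 ≤ Real.sin (Real.pi * t) :=
      Real.sin_nonneg_of_nonneg_of_le_pi (mul_nonneg Real.pi_pos.le t.2.1)
        (mul_le_of_le_one_right Real.pi_pos.le t.2.2)
    calc 0 ≤ δ * Real.sin (Real.pi * t) := mul_nonneg h.delta_pos.le h2
      _ = _ := by rw [← h1]; ring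

/-- Both paths bypass `ε ζʲ` on the same side. The half circle may leave the half sector, since `δ`
may exceed `ε sin (π/n)`. It is first replaced, within the punctured half disc, by a path `v` that
also stays in the half sector; then everything takes place in the punctured half sector. -/
lemma segment_halfCircle_outward {n : ℕ} (hn : 1 ≤ n) {ε δ : ℝ} (h : Small n ε δ) (j : ℕ) {σ : ℝ}
    (hσ : σ = 1 ∨ σ = -1) {a : ℝ} (ha : Complex.exp (a * Complex.I) ^ n = -1)
    (haσ : a = 2 * Real.pi * j / n + σ * (Real.pi / n)) :
    ((segmentPath hn h j).trans ((halfCircle hn h j hσ).trans (outward hn h j))).Homotopic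
      ((ray hn h ha).trans (arc hn h a (2 * Real.pi * j / n))) := by
  have hζ := zeta_pow_ne_zero n j
  have hε := h.eps_pos
  have hε2 := h.eps_le
  have hδ := h.delta_pos
  have hδε := h.delta_lt
  have hσσ : σ * σ = 1 := by rcases hσ with rfl | rfl <;> norm_num
  obtain ⟨η, hη, hηδ, hcos⟩ := exists_height hn hδ hδε
  -- All three punctured sets are star-shaped about this point, as it lies strictly off the real
  -- axis.
  set w₀ : ℂ := ε + ((σ * η : ℝ) : ℂ) * Complex.I with hw₀
  have hre : w₀.re = ε := by simp [hw₀]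
  have him : w₀.im = σ * η := by simp [hw₀]
  have him' : σ * w₀.im = η := by rw [him, ← mul_assoc, hσσ, one_mul]
  have hw₀D : w₀ ∈ halfDisc ε δ σ := by
    refine ⟨?_, by rw [him']; exact hη.le⟩
    rw [hw₀, add_sub_cancel_left, norm_mul, Complex.norm_I, mul_one, Complex.norm_real, norm_mul,
      Real.norm_of_nonneg hη.le]
    rcases hσ with rfl | rfl <;> simpa using hηδ
  have hw₀S : w₀ ∈ halfSector n σ :=
    ⟨halfDisc_lt_one h hw₀D, by rw [him']; exact hη.le, by rw [him', hre]; exact hcos⟩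
  have hpos : 0 < σ * w₀.im := by rw [him']; exact hη
  have star {K : Set ℂ} (hK : Convex ℝ K) (h1 : w₀ ∈ K) (h2 : ∀ w ∈ K, 0 ≤ σ * w.im) :
      StarConvex ℝ (zeta n ^ j * w₀) (rotate n j (K \ {(ε : ℂ)})) :=
    starConvex_rotate (hK.starConvex_diff_ofReal h1 hpos h2 ε)
  have starD := star (convex_halfDisc ε δ σ) hw₀D fun w hw => hw.2
  have starS := star (convex_halfSector n σ) hw₀S fun w hw => hw.2.1
  have starI := star ((convex_halfDisc ε δ σ).inter (convex_halfSector n σ)) ⟨hw₀D, hw₀S⟩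
    fun w hw => hw.1.2
  have subD := rotate_subset_fibre hn j (ε := ε) (K := halfDisc ε δ σ)
    (fun w hw => halfDisc_lt_one h hw) fun w hw => eq_of_pow_eq_of_mem_halfDisc hn h hw
  have subS := rotate_subset_fibre hn j (ε := ε) (K := halfSector n σ)
    (fun w hw => hw.1) fun w hw => eq_of_pow_eq_of_mem_halfSector hn hε hσ hw
  have subI : rotate n j ((halfDisc ε δ σ ∩ halfSector n σ) \ {(ε : ℂ)}) ⊆ fibre n ε :=
    fun z hz => subS ⟨hz.1.2, hz.2⟩
  have near_mem : (nearPoint hn h j : ℂ) ∈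
      rotate n j ((halfDisc ε δ σ ∩ halfSector n σ) \ {(ε : ℂ)}) := by
    refine mem_rotate_diff hn _ ⟨?_, ?_⟩
    · simpa using halfCircle_mem hn h j hσ 0
    · simp only [nearPoint, mul_div_cancel_left₀ _ hζ]
      exact_mod_cast ofReal_mem_halfSector hn hσ (r := ε - δ) (by linarith) (by linarith)
  have far_mem : (farPoint hn h j : ℂ) ∈
      rotate n j ((halfDisc ε δ σ ∩ halfSector n σ) \ {(ε : ℂ)}) := by
    refine mem_rotate_diff hn _ ⟨?_, ?_⟩
    · simpa using halfCircle_mem hn h j hσ 1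
    · simp only [farPoint, mul_div_cancel_left₀ _ hζ]
      exact_mod_cast ofReal_mem_halfSector hn hσ (r := ε + δ) (by linarith) (by linarith)
  -- The intersection of half disc and half sector, punctured at `ε`, is path connected and contains
  -- both ends of the half circle.
  obtain ⟨v, hv⟩ := Path.lift_of_joinedIn subI
    ((starI.isPathConnected (starI.mem ⟨_, near_mem⟩)).joinedIn _ near_mem _ far_mem)
  have hcv : (halfCircle hn h j hσ).Homotopic v :=
    Path.homotopic_of_starConvex starD subD _ _
      (fun t => mem_rotate_diff hn _ (halfCircle_mem hn h j hσ t))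
      fun t => ⟨(hv t).1.1, (hv t).2⟩
  refine ((Path.Homotopic.refl _).hcomp (hcv.hcomp (Path.Homotopic.refl _))).trans ?_
  have hdiv (r θ : ℝ) : (r : ℂ) * Complex.exp (θ * Complex.I) / zeta n ^ j =
      r * Complex.exp ((θ - 2 * Real.pi * j / n : ℝ) * Complex.I) := by
    rw [zeta_pow_eq, mul_div_assoc, ← Complex.exp_sub]
    congr 2
    push_cast
    ring
  refine Path.homotopic_of_starConvex starS subS _ _
    (fun t => mem_rotate_diff hn _ (Path.forall_trans (C := fun z : fibre n ε =>
      (z : ℂ) / zeta n ^ j ∈ halfSector n σ) (fun t => ?_)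
      (Path.forall_trans (C := fun z : fibre n ε => (z : ℂ) / zeta n ^ j ∈ halfSector n σ)
        (fun t => (hv t).1.2) fun t => ?_) t))
    (fun t => mem_rotate_diff hn _ (Path.forall_trans (C := fun z : fibre n ε =>
      (z : ℂ) / zeta n ^ j ∈ halfSector n σ) (fun t => ?_) (fun t => ?_) t))
  · have h1 : (segmentPath hn h j t : ℂ) / zeta n ^ j = ((t * (ε - δ) : ℝ) : ℂ) := by
      rw [coe_segmentPath]
      push_cast
      field_simp
    rw [h1]
    have := t.2.1
    have := t.2.2
    exact ofReal_mem_halfSector hn hσ (mul_nonneg t.2.1 (by linarith)) (by nlinarith)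
  · rw [coe_outward, mul_div_cancel_left₀ _ hζ]
    obtain ⟨h1, h2⟩ := outward_radius h t
    exact ofReal_mem_halfSector hn hσ (by linarith) h2
  · rw [coe_ray, hdiv, haσ, add_sub_cancel_left]
    exact polar_mem_halfSector hn hσ (mul_nonneg t.2.1 (by norm_num))
      (by linarith [t.2.2]) (by positivity) le_rfl
  · have h1 : (arc hn h a (2 * Real.pi * j / n) t : ℂ) / zeta n ^ j =
        ((3 / 4 : ℝ) : ℂ) * Complex.exp ((σ * ((1 - t) * (Real.pi / n)) : ℝ) * Complex.I) := by
      rw [coe_arc, hdiv, haσ]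
      congr 4
      ring
    rw [h1]
    have hπ : 0 ≤ Real.pi / n := by positivity
    exact polar_mem_halfSector hn hσ (by norm_num) (by norm_num)
      (mul_nonneg (by linarith [t.2.2]) hπ) (by nlinarith [t.2.1])

end

end FermatArrangement

/-! ### The product of the loops as one sector loop. -/

open CategoryTheory in
-- Both sides equal `(s ≫ l ≫ o) ≫ (s ≫ u ≫ o)⁻¹`. In the application `l` and `u` are the lower and
-- upper half circles, and the outward path `o` cancels.
lemma CategoryTheory.Groupoid.comp_inv_eq_of_factor {C : Type*} [Groupoid C]
    {b c d e p q : C} {s : b ⟶ c} {l u : c ⟶ d} {o : d ⟶ e} {r : b ⟶ p} {r' : b ⟶ q} {x : p ⟶ e}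
    {x' : q ⟶ e} (h : s ≫ l ≫ o = r ≫ x) (h' : s ≫ u ≫ o = r' ≫ x') :
    (s ≫ l ≫ Groupoid.inv u) ≫ Groupoid.inv s =
      (r ≫ x ≫ Groupoid.inv x') ≫ Groupoid.inv r' := by
  have h1 : (r ≫ x ≫ Groupoid.inv x') ≫ Groupoid.inv r' =
      (r ≫ x) ≫ Groupoid.inv (r' ≫ x') := by simp
  rw [h1, ← h, ← h']
  simp

lemma Path.Homotopic.Quotient.trans_symm_eq_of_factor {X : Type*} [TopologicalSpace X]
    {b c d e p q : X} {s : Path.Homotopic.Quotient b c} {l u : Path.Homotopic.Quotient c d}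
    {o : Path.Homotopic.Quotient d e}
    {r : Path.Homotopic.Quotient b p} {r' : Path.Homotopic.Quotient b q}
    {x : Path.Homotopic.Quotient p e} {x' : Path.Homotopic.Quotient q e}
    (h : s.trans (l.trans o) = r.trans x) (h' : s.trans (u.trans o) = r'.trans x') :
    (s.trans (l.trans u.symm)).trans s.symm = (r.trans (x.trans x'.symm)).trans r'.symm :=
  CategoryTheory.Groupoid.comp_inv_eq_of_factor (C := FundamentalGroupoid X) (b := ⟨b⟩) (c := ⟨c⟩)
    (d := ⟨d⟩) (e := ⟨e⟩) (p := ⟨p⟩) (q := ⟨q⟩) (s := s) (l := l) (u := u) (o := o) (r := r)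
    (r' := r') (x := x) (x' := x') h h'

lemma Path.trans_apply_eq_of_lift {X Y : Type*} [TopologicalSpace X] [TopologicalSpace Y]
    {f : Y → X} {x y z : X} {k l m : Y} {p : Path x y} {q : Path y z} {P : Path k l} {Q : Path l m}
    (hp : ∀ t, p t = f (P t)) (hq : ∀ t, q t = f (Q t)) (t : unitInterval) :
    (p.trans q) t = f ((P.trans Q) t) := by
  rw [Path.trans_apply, Path.trans_apply]
  split_ifs
  exacts [hp _, hq _]

namespace FermatArrangement

noncomputable section

/-- The loop in the fibre, based at the origin, around the point `ε ζʲ`. -/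
def fibreLoop {n : ℕ} (hn : 1 ≤ n) {ε δ : ℝ} (h : Small n ε δ) (j : ℕ) :
    Path (fibreBase hn h) (fibreBase hn h) :=
  ((segmentPath hn h j).trans (circlePath hn h j)).trans (segmentPath hn h j).symm

lemma fibreLoop_homotopic {n : ℕ} (hn : 1 ≤ n) {ε δ : ℝ} (h : Small n ε δ) (j : ℕ) {a b : ℝ}
    (ha : Complex.exp (a * Complex.I) ^ n = -1) (hb : Complex.exp (b * Complex.I) ^ n = -1)
    (haj : a = 2 * Real.pi * j / n + -1 * (Real.pi / n))
    (hbj : b = 2 * Real.pi * j / n + 1 * (Real.pi / n)) :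
    (fibreLoop hn h j).Homotopic (sectorLoop hn h ha hb) := by
  set β := 2 * Real.pi * j / n with hβ
  have harc : (arc hn h a b).Homotopic ((arc hn h a β).trans (arc hn h b β).symm) :=
    ((Path.Homotopic.refl _).hcomp (arc_symm hn h b β) |>.trans (arc_trans hn h a β b)).symm
  have h1 := segment_halfCircle_outward hn h j (Or.inr rfl) ha haj
  have h2 := segment_halfCircle_outward hn h j (Or.inl rfl) hb hbj
  rw [fibreLoop, circlePath_eq_trans]
  refine Path.Homotopic.trans ?_
    (((Path.Homotopic.refl _).hcomp harc).hcomp (Path.Homotopic.refl _)).symm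
  rw [← Path.Homotopic.Quotient.eq] at h1 h2 ⊢
  simp only [Path.Homotopic.Quotient.mk_trans, Path.Homotopic.Quotient.mk_symm] at h1 h2 ⊢
  exact Path.Homotopic.Quotient.trans_symm_eq_of_factor h1 h2

lemma sectorLoop_trans {n : ℕ} (hn : 1 ≤ n) {ε δ : ℝ} (h : Small n ε δ) {a b c : ℝ}
    (ha : Complex.exp (a * Complex.I) ^ n = -1) (hb : Complex.exp (b * Complex.I) ^ n = -1)
    (hc : Complex.exp (c * Complex.I) ^ n = -1) :
    ((sectorLoop hn h ha hb).trans (sectorLoop hn h hb hc)).Homotopic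
      (sectorLoop hn h ha hc) := by
  have harc := arc_trans hn h a b c
  rw [← Path.Homotopic.Quotient.eq] at harc ⊢
  simp only [sectorLoop, Path.Homotopic.Quotient.mk_trans,
    Path.Homotopic.Quotient.mk_symm] at harc ⊢
  rw [← harc]
  simp only [Path.Homotopic.Quotient.trans_assoc]
  -- The return along the ray at `b` cancels against the departure along it.
  rw [← Path.Homotopic.Quotient.trans_assoc (Path.Homotopic.Quotient.symm _)
    (Path.Homotopic.Quotient.mk (ray hn h hb)), Path.Homotopic.Quotient.symm_trans,
    Path.Homotopic.Quotient.refl_trans]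

lemma sectorLoop_self {n : ℕ} (hn : 1 ≤ n) {ε δ : ℝ} (h : Small n ε δ) {a : ℝ}
    (ha : Complex.exp (a * Complex.I) ^ n = -1) :
    (sectorLoop hn h ha ha).Homotopic (Path.refl _) := by
  have harc : (arc hn h a a).Homotopic (Path.refl _) :=
    (SimplyConnectedSpace.paths_homotopic (realSegment a a) (Path.refl a)).map
      ⟨_, continuous_outerPoint hn h⟩
  rw [← Path.Homotopic.Quotient.eq] at harc ⊢
  simp only [sectorLoop, Path.Homotopic.Quotient.mk_trans,
    Path.Homotopic.Quotient.mk_symm] at harc ⊢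
  rw [harc]
  simp

lemma exp_odd_mul_pow {n : ℕ} (hn : 1 ≤ n) (k : ℕ) :
    Complex.exp (((2 * k + 1) * Real.pi / n : ℝ) * Complex.I) ^ n = -1 := by
  have hn0 : (n : ℂ) ≠ 0 := by exact_mod_cast (by omega : n ≠ 0)
  rw [← Complex.exp_nat_mul, show (n : ℂ) * (((2 * k + 1) * Real.pi / n : ℝ) * Complex.I) =
    Real.pi * Complex.I + k * (2 * Real.pi * Complex.I) by push_cast; field_simp; ring,
    Complex.exp_periodic.nat_mul k, Complex.exp_pi_mul_I]

/-- The loop traversed last is the left factor, because `*` composes in the opposite order. -/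
lemma concatProd_append_singleton {X : Type*} [TopologicalSpace X] {x : X}
    (l : List (FundamentalGroup X x)) (p : FundamentalGroup X x) :
    concatProd (l ++ [p]) = p * concatProd l := by
  induction l with
  | nil => exact (one_mul p).trans (mul_one p).symm
  | cons q l ih =>
    change concatProd (l ++ [p]) * q = p * (concatProd l * q)
    rw [ih, mul_assoc]

/-- The homomorphism induced by the inclusion of the fibre. -/
def fibreHom {n : ℕ} (hn : 1 ≤ n) {ε δ : ℝ} (h : Small n ε δ) :
    FundamentalGroup (fibre n ε) (fibreBase hn h) →*
      FundamentalGroup (fermatComplement n) (basePoint hn h) :=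
  FundamentalGroup.map (fibreIncl hn h) (fibreBase hn h)

lemma cyclicProduct_eq {n : ℕ} (hn : 1 ≤ n) {ε δ : ℝ} (h : Small n ε δ) :
    cyclicProduct hn h = fibreHom hn h
      (FundamentalGroup.fromPath (Path.Homotopic.Quotient.mk
        (sectorLoop hn h (exp_odd_mul_pow hn 0) (exp_odd_mul_pow hn n)))) := by
  set φ := fibreHom hn h with hφ
  let G (j : ℕ) : FundamentalGroup (fibre n ε) (fibreBase hn h) :=
    FundamentalGroup.fromPath (Path.Homotopic.Quotient.mk (fibreLoop hn h j))
  -- The class `gᵢ` circles `ε ζⁿ⁻ⁱ`, so the reversed list runs through the exponents `1, …, n`.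
  have hlist : (List.range n).reverse.map (g hn h) =
      (List.range n).map fun k => φ (G (k + 1)) := by
    refine List.ext_getElem (by simp) fun i hi hi' => ?_
    have hin : i < n := by simpa using hi'
    simp only [List.getElem_map, List.getElem_reverse, List.getElem_range, List.length_range]
    change φ (G (n - (n - 1 - i))) = _
    rw [show n - (n - 1 - i) = i + 1 by omega]
  -- The induction needs partial products: the first `m` loops sweep the arguments from `π/n` to
  -- `(2m + 1)π/n`.
  have key (m : ℕ) : concatProd ((List.range m).map fun k => φ (G (k + 1))) =
      φ (FundamentalGroup.fromPath (Path.Homotopic.Quotient.mk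
        (sectorLoop hn h (exp_odd_mul_pow hn 0) (exp_odd_mul_pow hn m)))) := by
    induction m with
    | zero =>
      have h0 := Path.Homotopic.Quotient.eq.2 (sectorLoop_self hn h (exp_odd_mul_pow hn 0))
      rw [h0]
      exact (map_one φ).symm
    | succ m ih =>
      have hn0 : (n : ℝ) ≠ 0 := by exact_mod_cast (by omega : n ≠ 0)
      have hG := Path.Homotopic.Quotient.eq.2 (fibreLoop_homotopic hn h (m + 1)
        (exp_odd_mul_pow hn m)
        (exp_odd_mul_pow hn (m + 1)) (by push_cast; field_simp; ring)
        (by push_cast; field_simp))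
      have ht := Path.Homotopic.Quotient.eq.2 (sectorLoop_trans hn h
        (exp_odd_mul_pow hn 0) (exp_odd_mul_pow hn m)
        (exp_odd_mul_pow hn (m + 1)))
      rw [List.range_succ, List.map_append, List.map_singleton, concatProd_append_singleton, ih,
        ← map_mul, ← ht, Path.Homotopic.Quotient.mk_trans, ← hG]
      rfl
  rw [cyclicProduct, hlist, key]

/-! ### Leaving the fibre. -/

lemma norm_ofReal_mul_turn {ε : ℝ} (hε : 0 ≤ ε) (t : ℝ) :
    ‖(ε : ℂ) * Complex.exp (2 * Real.pi * Complex.I * t)‖ = ε := by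
  rw [norm_mul, norm_exp_turn, Complex.norm_real, Real.norm_of_nonneg hε, mul_one]

lemma affinePoint_mem_of_norm_lt {n : ℕ} (hn : 1 ≤ n) {y z : ℂ} (hyz : ‖y‖ < ‖z‖)
    (hz : ‖z‖ < 1) : affinePoint y z ∈ fermatComplement n :=
  affinePoint_mem (pow_ne_one_of_norm_lt hn (hyz.trans hz)) (pow_ne_pow_of_norm_lt hn hyz).symm
    (pow_ne_one_of_norm_lt hn hz)

lemma bidisc_mem {n : ℕ} (hn : 1 ≤ n) {ε δ : ℝ} (h : Small n ε δ) {y : ℂ} (hy : ‖y‖ ≤ ε) (θ : ℝ) :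
    affinePoint y (((3 / 4 : ℝ) : ℂ) * Complex.exp (θ * Complex.I)) ∈ fermatComplement n := by
  refine affinePoint_mem_of_norm_lt hn ?_ ?_ <;> rw [norm_ofReal_mul_exp (by norm_num)]
  · linarith [h.eps_le]
  · norm_num

/-- The path along which both coordinates make a full turn, from argument `a` of the second. -/
def diagonalArc {n : ℕ} (hn : 1 ≤ n) {ε δ : ℝ} (h : Small n ε δ) (a : ℝ) :
    Path (fibreIncl hn h (outerPoint hn h a))
      (fibreIncl hn h (outerPoint hn h (a + 2 * Real.pi))) where
  toFun t := ⟨affinePoint ((ε : ℂ) * Complex.exp (2 * Real.pi * Complex.I * (t : ℝ)))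
    (((3 / 4 : ℝ) : ℂ) * Complex.exp ((a + t * (2 * Real.pi) : ℝ) * Complex.I)),
    bidisc_mem hn h (norm_ofReal_mul_turn h.eps_pos.le t).le _⟩
  continuous_toFun := by
    refine Continuous.subtype_mk (continuous_affinePoint.comp (Continuous.prodMk ?_ ?_)) _ <;>
    fun_prop
  source' := by simp [fibreIncl, outerPoint]
  target' := by simp [fibreIncl, outerPoint]

/-- Both paths lift to (disc `|y| ≤ ε`) × (line of arguments), which is convex; its image avoids the
arrangement because `|y| < |z| < 1` there. -/
lemma arc_homotopic_diagonalArc {n : ℕ} (hn : 1 ≤ n) {ε δ : ℝ} (h : Small n ε δ) (a : ℝ) :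
    ((arc hn h a (a + 2 * Real.pi)).map (fibreIncl hn h).continuous).Homotopic
      (diagonalArc hn h a) := by
  let K : Set (ℂ × ℝ) := Metric.closedBall 0 ε ×ˢ Set.univ
  have hε : ‖(ε : ℂ)‖ ≤ ε := by rw [Complex.norm_real, Real.norm_of_nonneg h.eps_pos.le]
  have hmem {y : ℂ} (θ : ℝ) (hy : ‖y‖ ≤ ε) : (y, θ) ∈ K := ⟨by simpa using hy, trivial⟩
  have hK : Convex ℝ K := (convex_closedBall (0 : ℂ) ε).prod convex_univ
  have : ContractibleSpace K := hK.contractibleSpace ⟨_, hmem a hε⟩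
  let f (w : K) : fermatComplement n :=
    ⟨affinePoint w.1.1 (((3 / 4 : ℝ) : ℂ) * Complex.exp (w.1.2 * Complex.I)),
      bidisc_mem hn h (by simpa using w.2.1) _⟩
  have hf : Continuous f := by
    refine Continuous.subtype_mk (continuous_affinePoint.comp (Continuous.prodMk ?_ ?_)) _ <;>
    fun_prop
  let P : Path (⟨(ε, a), hmem _ hε⟩ : K) ⟨(ε, a + 2 * Real.pi), hmem _ hε⟩ :=
    { toFun := fun t => ⟨(ε, a + t * (2 * Real.pi)), hmem _ hε⟩
      continuous_toFun := by
        refine Continuous.subtype_mk ?_ _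
        fun_prop
      source' := by simp
      target' := by simp }
  let Q : Path (⟨(ε, a), hmem _ hε⟩ : K) ⟨(ε, a + 2 * Real.pi), hmem _ hε⟩ :=
    { toFun := fun t => ⟨((ε : ℂ) * Complex.exp (2 * Real.pi * Complex.I * (t : ℝ)),
        a + t * (2 * Real.pi)), hmem _ (norm_ofReal_mul_turn h.eps_pos.le t).le⟩
      continuous_toFun := by
        refine Continuous.subtype_mk ?_ _
        fun_prop
      source' := by simp
      target' := by simp }
  refine Path.homotopic_of_lift hf P Q _ _ (fun t => Subtype.ext ?_) fun _ => rfl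
  change affinePoint ε (arc hn h a (a + 2 * Real.pi) t : ℂ) = affinePoint ε _
  rw [coe_arc, add_sub_cancel_left]
  rfl

lemma diagonal_mem {n : ℕ} (hn : 1 ≤ n) {ε δ : ℝ} (h : Small n ε δ) {a : ℝ}
    (ha : Complex.exp (a * Complex.I) ^ n = -1) {s : ℝ} (hs : 0 ≤ s) (hs1 : s ≤ 1) (φ : ℝ) :
    affinePoint ((ε : ℂ) * Complex.exp (2 * Real.pi * Complex.I * φ))
      (((s * (3 / 4) : ℝ) : ℂ) * Complex.exp ((a + φ * (2 * Real.pi) : ℝ) * Complex.I)) ∈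
      fermatComplement n := by
  have hs' : 0 ≤ s * (3 / 4) := by positivity
  refine affinePoint_mem (pow_ne_one_of_norm_lt hn ?_) (fun heq => ?_)
    (pow_ne_one_of_norm_lt hn ?_)
  · rw [norm_ofReal_mul_turn h.eps_pos.le]
    linarith [h.eps_le]
  -- The common rotation of `y` and `z` cancels from `yⁿ = zⁿ`, which leaves the equation excluded
  -- on the ray.
  · refine ray_pow_ne hs' h.eps_pos ha (mul_right_cancel₀ (pow_ne_zero n
      (Complex.exp_ne_zero (2 * Real.pi * Complex.I * φ))) ?_)
    rw [← mul_pow, ← mul_pow, heq, mul_assoc, ← Complex.exp_add]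
    congr 3
    push_cast
    ring
  · rw [norm_ofReal_mul_exp hs']
    linarith

/-- Here `f` is defined on a strip with coordinates `(s, φ)`: `s` scales `z` and `φ` turns both
coordinates. Three sides of the unit square give the left-hand loop; the fourth, `s = 0`, gives the
image of `γ₀`. -/
lemma diagonal_homotopic {n : ℕ} (hn : 1 ≤ n) {ε δ : ℝ} (h : Small n ε δ) {a : ℝ}
    (ha : Complex.exp (a * Complex.I) ^ n = -1)
    (hb : Complex.exp ((a + 2 * Real.pi : ℝ) * Complex.I) ^ n = -1) :
    ((((ray hn h ha).map (fibreIncl hn h).continuous).trans (diagonalArc hn h a)).trans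
      ((ray hn h hb).map (fibreIncl hn h).continuous).symm).Homotopic
      ((gammaZeroLoop h).map (incl hn h).continuous) := by
  let K : Set (ℝ × ℝ) := Set.Icc 0 1 ×ˢ Set.univ
  have hmem (s : unitInterval) (φ : ℝ) : ((s : ℝ), φ) ∈ K := ⟨s.2, trivial⟩
  have : ContractibleSpace K :=
    ((convex_Icc (0 : ℝ) 1).prod convex_univ).contractibleSpace ⟨_, hmem 0 0⟩
  let pt (s : unitInterval) (φ : ℝ) : K := ⟨(s, φ), hmem s φ⟩
  have hpt : Continuous fun w : unitInterval × ℝ => pt w.1 w.2 := by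
    refine Continuous.subtype_mk ?_ _
    fun_prop
  let f (w : K) : fermatComplement n :=
    ⟨affinePoint ((ε : ℂ) * Complex.exp (2 * Real.pi * Complex.I * w.1.2))
      (((w.1.1 * (3 / 4) : ℝ) : ℂ) * Complex.exp ((a + w.1.2 * (2 * Real.pi) : ℝ) * Complex.I)),
      diagonal_mem hn h ha w.2.1.1 w.2.1.2 _⟩
  have hf : Continuous f := by
    refine Continuous.subtype_mk (continuous_affinePoint.comp (Continuous.prodMk ?_ ?_)) _ <;>
    fun_prop
  let horizontal (φ : ℝ) : Path (pt 0 φ) (pt 1 φ) :=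
    { toFun := fun t => pt t φ
      continuous_toFun := hpt.comp (continuous_id.prodMk continuous_const)
      source' := rfl
      target' := rfl }
  let vertical (s : unitInterval) : Path (pt s 0) (pt s 1) :=
    { toFun := fun t => pt s t
      continuous_toFun := hpt.comp (continuous_const.prodMk continuous_subtype_val)
      source' := by simp
      target' := by simp }
  refine Path.homotopic_of_lift hf (((horizontal 0).trans (vertical 1)).trans (horizontal 1).symm)
    (vertical 0) _ _ (Path.trans_apply_eq_of_lift (Path.trans_apply_eq_of_lift (fun t => ?_)
      fun t => ?_) fun t => ?_) fun t => ?_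
  · refine Subtype.ext ?_
    change affinePoint ε (ray hn h ha t : ℂ) = affinePoint (ε * Complex.exp (2 * Real.pi * Complex.I
      * (0 : ℝ))) (((t * (3 / 4) : ℝ) : ℂ) *
        Complex.exp ((a + 0 * (2 * Real.pi) : ℝ) * Complex.I))
    simp [coe_ray]
  · refine Subtype.ext ?_
    change affinePoint _ _ = affinePoint (ε * Complex.exp (2 * Real.pi * Complex.I * (t : ℝ)))
      ((((1 : ℝ) * (3 / 4) : ℝ) : ℂ) * Complex.exp ((a + t * (2 * Real.pi) : ℝ) * Complex.I))
    rw [one_mul]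
  · refine Subtype.ext ?_
    change affinePoint ε (ray hn h hb (unitInterval.symm t) : ℂ) =
      affinePoint (ε * Complex.exp (2 * Real.pi * Complex.I * (1 : ℝ)))
        (((unitInterval.symm t * (3 / 4) : ℝ) : ℂ) *
          Complex.exp ((a + 1 * (2 * Real.pi) : ℝ) * Complex.I))
    simp [coe_ray]
  · refine Subtype.ext ?_
    change affinePoint (ε * Complex.exp (2 * Real.pi * Complex.I * (t : ℝ))) 0 =
      affinePoint (ε * Complex.exp (2 * Real.pi * Complex.I * (t : ℝ)))
        ((((0 : ℝ) * (3 / 4) : ℝ) : ℂ) * Complex.exp ((a + t * (2 * Real.pi) : ℝ) * Complex.I))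
    simp

lemma sectorLoop_map {n : ℕ} (hn : 1 ≤ n) {ε δ : ℝ} (h : Small n ε δ) {a b : ℝ}
    (ha : Complex.exp (a * Complex.I) ^ n = -1) (hb : Complex.exp (b * Complex.I) ^ n = -1) :
    (sectorLoop hn h ha hb).map (fibreIncl hn h).continuous =
      (((ray hn h ha).map (fibreIncl hn h).continuous).trans
        ((arc hn h a b).map (fibreIncl hn h).continuous)).trans
        ((ray hn h hb).map (fibreIncl hn h).continuous).symm := by
  rw [sectorLoop, Path.map_trans, Path.map_trans, ← Path.map_symm]

lemma sectorLoop_homotopic_gammaZeroLoop {n : ℕ} (hn : 1 ≤ n) {ε δ : ℝ} (h : Small n ε δ)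
    {a b : ℝ} (ha : Complex.exp (a * Complex.I) ^ n = -1)
    (hb : Complex.exp (b * Complex.I) ^ n = -1) (hab : b = a + 2 * Real.pi) :
    ((sectorLoop hn h ha hb).map (fibreIncl hn h).continuous).Homotopic
      ((gammaZeroLoop h).map (incl hn h).continuous) := by
  subst hab
  have hmap : ((sectorLoop hn h ha hb).map (fibreIncl hn h).continuous).Homotopic
      ((((ray hn h ha).map (fibreIncl hn h).continuous).trans (diagonalArc hn h a)).trans
        ((ray hn h hb).map (fibreIncl hn h).continuous).symm) := by
    rw [sectorLoop_map]
    exact ((Path.Homotopic.refl _).hcomp (arc_homotopic_diagonalArc hn h a)).hcomp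
      (Path.Homotopic.refl _)
  exact hmap.trans (diagonal_homotopic hn h ha hb)

end

end FermatArrangement

theorem mainTheorem7 (n : ℕ) (hn : 1 ≤ n) (ε δ : ℝ) (h : FermatArrangement.Small n ε δ) :
    FundamentalGroup.map (FermatArrangement.incl hn h) (FermatArrangement.discBase h)
        (FermatArrangement.gammaZero h) =
      FermatArrangement.cyclicProduct hn h := by
  have hn0 : (n : ℝ) ≠ 0 := by exact_mod_cast (by omega : n ≠ 0)
  rw [FermatArrangement.cyclicProduct_eq]
  exact (Path.Homotopic.Quotient.eq.2 (FermatArrangement.sectorLoop_homotopic_gammaZeroLoop hn h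
    (FermatArrangement.exp_odd_mul_pow hn 0) (FermatArrangement.exp_odd_mul_pow hn n)
    (by push_cast; field_simp; ring))).symm
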